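/- Let $\mathbb F_q$ be a finite field with $q$ elements, let $k\ge 1$ and $\delta\ge 0$ be integers, and put $n=q^{\delta}\frac{q^k-1}{q-1}$ and $\mu=\lceil \delta/k\rceil$. \emph{Definitions.} An $(n,k)$ convolutional code is an $\mathbb F_q[z]$-submodule $\mathcal C\subseteq\mathbb F_q[z]^n$ of rank $k$; a generator matrix of $\mathcal C$ is a matrix $G(z)=\sum_i G_iz^i\in\mathbb F_q[z]^{k\times n}$ whose rows form a basis of $\mathcal C$. It is called minimal if it is row reduced, i.e. if the sum of its row degrees equals the maximal degree of its $k\times k$ minors; this common value is the degree $\delta$ of $\mathcal C$, and $\mathcal C$ is then called an $(n,k,\delta)$ convolutional code. $\mathcal C$ is delay-free if it has a generator matrix with $G_0$ of full row rank, and non-catastrophic if there is a matrix $H(z)\in\mathbb F_q[z]^{(n-k)\times n}$ of full rank with $\mathcal C=\{v(z)\in\mathbb F_q[z]^n : H(z)v(z)^\top=0\}$. With $\operatorname{wt}$ the Hamming weight (summed over all coefficient vectors $v_t$ of $v(z)=\sum_t v_tz^t$), put $$d_{free}(\mathcal C)=\min\{\operatorname{wt}(v(z)) : v(z)\in\mathcal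 C,\ v(z)\ne 0\},\qquad d_j^c(\mathcal C)=\min\{\operatorname{wt}(v_0,\dots,v_j) : v(z)\in\mathcal C,\ v_0\neq 0\}\quad (j\ge 0).$$ A delay-free $(n,k,\delta)$ convolutional code $\mathcal C$ has optimal column distances if there is no delay-free $(n,k,\delta)$ convolutional code $\hat{\mathcal C}\subseteq\mathbb F_q[z]^n$ and no $j\ge0$ with $d_j^c(\hat{\mathcal C})>d_j^c(\mathcal C)$ and $d_i^c(\hat{\mathcal C})=d_i^c(\mathcal C)$ for all $0\le i<j$. \emph{Construction.} Let $S(q,k)\in\mathbb F_q^{k\times\frac{q^k-1}{q-1}}$ be a matrix whose columns form a set of representatives of the one-dimensional subspaces of $\mathbb F_q^k$ (a generator matrix of a simplex code). Let $x_1,\dots,x_{q^\delta}$ be the elements of $\mathbb F_q^\delta$ in some order, and let $X_i=(x_i,\dots,x_i)\in\mathbb F_q^{\delta\times\frac{q^k-1}{q-1}}$. Let $G(z)=\sum_{i=0}^{\mu}G_iz^i\in\mathbb F_q[z]^{k\times n}$ be such that, for some choice of $\delta+k-k\mu$ rows of $G_\mu$, all other rows of $G_\mu$ are zero and, with $\tilde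 G_\mu$ denoting the matrix of the chosen rows (in their order), $$\begin{pmatrix}G_0\\ \vdots\\ G_{\mu-1}\\ \tilde G_\mu\end{pmatrix}=\begin{pmatrix}S(q,k)&\cdots&S(q,k)\\ X_1&\cdots&X_{q^\delta}\end{pmatrix}.$$ \textbf{Theorem (Construction 1).} The block matrix on the right is a generator matrix $C_{\delta+k,\delta}(q)$ of a MacDonald code, i.e. it is obtained, up to the order of the columns, from a matrix whose columns form a set of representatives of the one-dimensional subspaces of $\mathbb F_q^{\delta+k}$ by deleting the columns whose first $k$ entries are all zero. The matrix $G(z)$ is a minimal generator matrix of an $(n,k,\delta)$ convolutional code $\mathcal C$. This code is non-catastrophic and (delay-free) with optimal column distances, and these are $$d_j^c(\mathcal C)=\begin{cases} q^{\delta+k-1}+j\,(q^{\delta+k-1}-q^{\delta-1}) & \text{for } j\le\lfloor\delta/k\rfloor,\\ q^{\delta+k-1}+\lfloor\delta/k\rfloor\,(q^{\delta+k-1}-q^{\delta-1}) & \text{for } j\ge\lfloor\delta/k\rfloor.\end{cases}$$ Moreover, $$d_{free}(\mathcal C)=q^{\delta+k-1}+\lfloor\delta/k\rfloor\,(q^{\delta+k-1}-q^{\delta-1}).$$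 -/

import Mathlib

open Polynomial

namespace ConvolutionalCode

variable {F : Type*} [Field F] {n k : ℕ}

/-- The coefficient vector `v_t ∈ F^n` of `v(z) = ∑ v_t z^t ∈ F[z]^n`. -/
def coeffVec (v : Fin n → F[X]) (t : ℕ) : Fin n → F := fun c => (v c).coeff t

/-- The coefficient matrix `G_i` of `G(z) = ∑ G_i z^i`. -/
def coeffMatrix (G : Matrix (Fin k) (Fin n) F[X]) (i : ℕ) : Matrix (Fin k) (Fin n) F :=
  G.map fun p => p.coeff i

/-- The submodule of `F[z]^n` generated by the rows of `G(z)`. -/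
noncomputable def codeOf (G : Matrix (Fin k) (Fin n) F[X]) : Submodule F[X] (Fin n → F[X]) :=
  Submodule.span F[X] (Set.range G.row)

/-- The rows of `G(z)` form a basis of `C`. -/
def IsGeneratorMatrix (G : Matrix (Fin k) (Fin n) F[X])
    (C : Submodule F[X] (Fin n → F[X])) : Prop :=
  LinearIndependent F[X] G.row ∧ codeOf G = C

/-- The largest degree of an entry of row `i`. -/
def rowDegree (G : Matrix (Fin k) (Fin n) F[X]) (i : Fin k) : ℕ :=
  Finset.univ.sup fun c => (G i c).natDegree

/-- The sum of the row degrees. -/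
def externalDegree (G : Matrix (Fin k) (Fin n) F[X]) : ℕ := ∑ i, rowDegree G i

/-- The largest degree of a `k × k` minor; a minor is given by an increasing choice of `k` columns. -/
noncomputable def internalDegree (G : Matrix (Fin k) (Fin n) F[X]) : ℕ :=
  Finset.univ.sup fun f : Fin k ↪o Fin n => (G.submatrix id f).det.natDegree

def IsRowReduced (G : Matrix (Fin k) (Fin n) F[X]) : Prop :=
  internalDegree G = externalDegree G

def IsMinimalGeneratorMatrix (G : Matrix (Fin k) (Fin n) F[X])
    (C : Submodule F[X] (Fin n → F[X])) : Prop :=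
  IsGeneratorMatrix G C ∧ IsRowReduced G

/-- `C` is an `(n, k, δ)` convolutional code: a submodule of `F[z]^n` of rank `k` and degree `δ`,
the degree being the external degree of a minimal generator matrix. -/
def IsConvCode (C : Submodule F[X] (Fin n → F[X])) (k δ : ℕ) : Prop :=
  Module.finrank F[X] C = k ∧
    ∃ G : Matrix (Fin k) (Fin n) F[X], IsMinimalGeneratorMatrix G C ∧ externalDegree G = δ

/-- `C`, of rank `k`, has a generator matrix whose constant coefficient `G_0` has full row rank. -/
def IsDelayFree (C : Submodule F[X] (Fin n → F[X])) (k : ℕ) : Prop :=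
  ∃ G : Matrix (Fin k) (Fin n) F[X],
    IsGeneratorMatrix G C ∧ LinearIndependent F (coeffMatrix G 0).row

/-- `C`, of rank `k`, admits a parity-check matrix: an `(n-k) × n` polynomial matrix `H(z)` of full
(row) rank with `C = {v(z) | H(z) v(z)ᵀ = 0}`. -/
def IsNonCatastrophic (C : Submodule F[X] (Fin n → F[X])) (k : ℕ) : Prop :=
  ∃ H : Matrix (Fin (n - k)) (Fin n) F[X],
    LinearIndependent F[X] H.row ∧ ∀ v : Fin n → F[X], v ∈ C ↔ H.mulVec v = 0

section Distances

variable [DecidableEq F]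

/-- The Hamming weight `∑_t wt(v_t)` of `v(z)`; only finitely many terms are nonzero. -/
noncomputable def weight (v : Fin n → F[X]) : ℕ := ∑ᶠ t : ℕ, hammingNorm (coeffVec v t)

/-- The Hamming weight of `(v_0, …, v_j)`. -/
def truncWeight (j : ℕ) (v : Fin n → F[X]) : ℕ :=
  ∑ t ∈ Finset.range (j + 1), hammingNorm (coeffVec v t)

noncomputable def freeDistance (C : Submodule F[X] (Fin n → F[X])) : ℕ :=
  sInf {w | ∃ v ∈ C, v ≠ 0 ∧ weight v = w}

/-- The `j`-th column distance. -/
noncomputable def columnDistance (C : Submodule F[X] (Fin n → F[X])) (j : ℕ) : ℕ :=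
  sInf {w | ∃ v ∈ C, coeffVec v 0 ≠ 0 ∧ truncWeight j v = w}

/-- `C` is a delay-free `(n, k, δ)` convolutional code with optimal column distances: no delay-free
`(n, k, δ)` convolutional code has a lexicographically larger sequence of column distances. -/
def HasOptimalColumnDistances (C : Submodule F[X] (Fin n → F[X])) (k δ : ℕ) : Prop :=
  IsConvCode C k δ ∧ IsDelayFree C k ∧
    ¬ ∃ C' : Submodule F[X] (Fin n → F[X]), IsConvCode C' k δ ∧ IsDelayFree C' k ∧
      ∃ j : ℕ, columnDistance C j < columnDistance C' j ∧
        ∀ i < j, columnDistance C' i = columnDistance C i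

end Distances

section BlockCodes

/-- The columns of `S` form a set of representatives of the one-dimensional subspaces of `F^m`. -/
def IsSimplexMatrix {m N : ℕ} (S : Matrix (Fin m) (Fin N) F) : Prop :=
  (∀ j, S.col j ≠ 0) ∧
    ∀ v : Fin m → F, v ≠ 0 → ∃! j, Submodule.span F {S.col j} = Submodule.span F {v}

/-- `M` is a generator matrix of the MacDonald code `𝒞_{k+δ,δ}`: it arises from a generator matrix
of the simplex code of dimension `k + δ` by deleting the columns whose first `k` entries vanish. -/
def IsMacDonaldMatrix {δ : ℕ} (M : Matrix (Fin (k + δ)) (Fin n) F) : Prop :=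
  ∃ (N : ℕ) (S : Matrix (Fin (k + δ)) (Fin N) F), IsSimplexMatrix S ∧
    ∃ e : Fin n ≃ {j : Fin N // ∃ i : Fin k, S (Fin.castAdd δ i) j ≠ 0},
      ∀ p c, M p c = S p (e c)

/-- The block matrix `(S ⋯ S ; X_1 ⋯ X_L)` with `X_b = (x_b, …, x_b)`: the column with index
`(b, j)`, the `j`-th one of the `b`-th block, is the `j`-th column of `S` on top of `x_b`. -/
def macDonaldBlocks {δ L N : ℕ} (S : Matrix (Fin k) (Fin N) F) (x : Fin L → Fin δ → F) :
    Matrix (Fin (k + δ)) (Fin (L * N)) F :=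
  fun p c =>
    Fin.append (fun i => S i (finProdFinEquiv.symm c).2) (x (finProdFinEquiv.symm c).1) p

/-- The stacked matrix `(G_0 ; … ; G_{μ-1} ; G̃_μ)` with `μ = ⌈δ/k⌉`, where `G̃_μ` consists of the
rows `σ 0 < σ 1 < ⋯` of `G_μ`: row number `i k + r` is row `r` of `G_i` for `i < μ`, and row number
`μ k + s` is row `σ s` of `G_μ`. -/
def stackedCoeffs {δ : ℕ} (σ : Fin (k + δ - k * (δ ⌈/⌉ k)) ↪o Fin k)
    (G : Matrix (Fin k) (Fin n) F[X]) : Matrix (Fin (k + δ)) (Fin n) F :=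
  fun p c =>
    if h : (p : ℕ) < k * (δ ⌈/⌉ k) then
      coeffMatrix G (p / k) ⟨p % k, Nat.mod_lt _ (Nat.pos_of_mul_pos_right (Nat.zero_lt_of_lt h))⟩ c
    else
      coeffMatrix G (δ ⌈/⌉ k) (σ ⟨p - k * (δ ⌈/⌉ k), by have := p.isLt; omega⟩) c

end BlockCodes

end ConvolutionalCode

open ConvolutionalCode

/-! Let `q = |F|`, and let `M` be the block matrix with columns `(s_j, x_b)`. For fixed `s_j`, a
combination of rows with nonzero coefficients among the last `δ` is a nonconstant affine function of
`x_b`, hence nonzero at `(q-1) q^(δ-1)` points; this gives weight `q^(δ+k-1) - q^(δ-1)`. Any other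
nonzero combination repeats a simplex codeword `q^δ` times and has weight `q^(δ+k-1)`. In particular
the rows of `M` are independent.

Row `(i, r)` of `M` is row `r` of `G_i`, so the coefficient vector `v_t` of `uG` is a combination of
rows of `M`, with coefficient `u_{r,t-i}` at row `(i, r)`. Only the first `k` rows enter `v_0`.
Every row of `G` has degree at least `⌊δ/k⌋`, so if `u_{r,0} ≠ 0`, then for `0 < t ≤ ⌊δ/k⌋` this
scalar stands at row `(t, r)`, among the last `δ`. All truncated weights up to time `⌊δ/k⌋` are thus
known exactly. Some row of `G` has degree at most `⌊δ/k⌋` and gains no weight afterwards, which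
settles the column distances and the free distance.

Optimality is the equality case of a Plotkin argument (`truncWeight_eq_of_le`). If a rival does at
least as well up to some time in the window, averaging over the row space of its `G_0`, and then
over the translates of that space by `v_t`, forces all its truncated weights to equal these values.
A rival also has a row of degree at most `⌊δ/k⌋`, so it cannot win later either.

Independence of the rows of `M` also gives the algebraic claims: leading row coefficients are
distinct rows of `M`, so `G` is row reduced, and a right inverse of `M` over `F` contains a constant
right inverse of `G`. -/

namespace ConvolutionalCode

/-! ### Averaging Hamming weights over linear codes and their translates -/

section Counting

variable {F : Type*} [Field F] [Fintype F] [DecidableEq F] {ι : Type*} [Fintype ι] [DecidableEq ι]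

/-- An affine hyperplane of `F^ι` has `q^(|ι|-1)` points. -/
theorem card_mul_card_dotProduct_eq {a : ι → F} (ha : a ≠ 0) (b : F) :
    Fintype.card F * (Finset.univ.filter fun c : ι → F => c ⬝ᵥ a = b).card =
      Fintype.card F ^ Fintype.card ι := by
  obtain ⟨i, hi⟩ := Function.ne_iff.mp ha
  have hc : ∀ b' : F, (Finset.univ.filter fun c : ι → F => c ⬝ᵥ a = b').card =
      (Finset.univ.filter fun c : ι → F => c ⬝ᵥ a = b).card := by
    intro b'
    have key : ∀ t : F, Pi.single i (t / a i) ⬝ᵥ a = t := by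
      intro t
      rw [single_dotProduct, div_mul_cancel₀ _ hi]
    -- Translation along a coordinate where `a` is nonzero carries each fibre of the form onto any
    -- other.
    refine Finset.card_bij' (fun c _ => c + Pi.single i ((b - b') / a i))
      (fun c _ => c + Pi.single i ((b' - b) / a i)) ?_ ?_ ?_ ?_
    · intro c hc
      simp only [Finset.mem_filter, Finset.mem_univ, true_and] at hc ⊢
      rw [add_dotProduct, key, hc]; ring
    · intro c hc
      simp only [Finset.mem_filter, Finset.mem_univ, true_and] at hc ⊢
      rw [add_dotProduct, key, hc]; ring
    · intro c _
      rw [add_assoc, ← Pi.single_add, ← add_div]; simp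
    · intro c _
      rw [add_assoc, ← Pi.single_add, ← add_div]; simp
  have h := Finset.card_eq_sum_card_fiberwise (s := (Finset.univ : Finset (ι → F)))
    (t := (Finset.univ : Finset F)) (f := fun c => c ⬝ᵥ a) (fun _ _ => Finset.mem_coe.mpr (Finset.mem_univ _))
  simp only [hc, Finset.sum_const, smul_eq_mul, Finset.card_univ, Fintype.card_fun] at h
  exact h.symm

theorem card_mul_card_dotProduct_add_ne {a : ι → F} (ha : a ≠ 0) (b : F) :
    Fintype.card F * (Finset.univ.filter fun c : ι → F => c ⬝ᵥ a + b ≠ 0).card =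
      (Fintype.card F - 1) * Fintype.card F ^ Fintype.card ι := by
  have h1 := card_mul_card_dotProduct_eq ha (-b)
  have h2 := Finset.card_filter_add_card_filter_not (s := (Finset.univ : Finset (ι → F)))
    (fun c => c ⬝ᵥ a + b = 0)
  simp only [← eq_neg_iff_add_eq_zero] at h2 ⊢
  rw [Finset.card_univ, Fintype.card_fun] at h2
  rw [Nat.sub_mul, one_mul]
  nth_rewrite 1 [← h2]
  rw [mul_add, h1, Nat.add_sub_cancel_left]
  simp only [ne_eq, ← eq_neg_iff_add_eq_zero]

/-- Double counting by columns: a nonzero column gives a nonzero entry for the fraction `(q-1)/q` of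
all `c`, whatever the shift `w`. -/
theorem card_mul_sum_hammingNorm_vecMul_add {k n : ℕ} (M : Matrix (Fin k) (Fin n) F)
    (hM : ∀ j, M.col j ≠ 0) (w : Fin n → F) :
    Fintype.card F * ∑ c : Fin k → F, hammingNorm (Matrix.vecMul c M + w) =
      n * ((Fintype.card F - 1) * Fintype.card F ^ k) := by
  simp only [hammingNorm, Finset.card_filter, Pi.add_apply]
  rw [Finset.sum_comm, Finset.mul_sum]
  simp only [← Finset.card_filter]
  refine (Finset.sum_congr rfl fun j _ => card_mul_card_dotProduct_add_ne (hM j) (w j)).trans ?_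
  simp

theorem card_mul_sum_hammingNorm_vecMul {k n : ℕ} (M : Matrix (Fin k) (Fin n) F) :
    Fintype.card F * ∑ c : Fin k → F, hammingNorm (Matrix.vecMul c M) =
      (Finset.univ.filter fun j => M.col j ≠ 0).card *
        ((Fintype.card F - 1) * Fintype.card F ^ k) := by
  simp only [hammingNorm, Finset.card_filter]
  rw [Finset.sum_comm, Finset.mul_sum, Finset.sum_mul]
  simp only [← Finset.card_filter]
  refine Finset.sum_congr rfl fun j _ => ?_
  by_cases h : M.col j = 0
  · have h0 : ∀ c : Fin k → F, Matrix.vecMul c M j = 0 := fun c => by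
      change c ⬝ᵥ M.col j = 0
      rw [h, dotProduct_zero]
    simp [h, h0]
  · have := card_mul_card_dotProduct_add_ne h (0 : F)
    simp only [add_zero, Fintype.card_fin] at this
    simp only [ne_eq, h, not_false_eq_true, if_true, one_mul]
    exact this

/-- The equality case of the Plotkin bound for linear codes. -/
theorem hammingNorm_vecMul_eq_of_le {k δ n : ℕ} (hk : 0 < k)
    (hn : n * (Fintype.card F - 1) = Fintype.card F ^ δ * (Fintype.card F ^ k - 1))
    (M : Matrix (Fin k) (Fin n) F)
    (hM : ∀ c ≠ 0, Fintype.card F ^ (δ + k - 1) ≤ hammingNorm (Matrix.vecMul c M)) :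
    (∀ j, M.col j ≠ 0) ∧
      ∀ c ≠ 0, hammingNorm (Matrix.vecMul c M) = Fintype.card F ^ (δ + k - 1) := by
  have hq : 1 < Fintype.card F := Fintype.one_lt_card
  have hs := card_mul_sum_hammingNorm_vecMul M
  set q := Fintype.card F
  set Z := (Finset.univ.filter fun j => M.col j ≠ 0).card with hZdef
  have hZ : Z ≤ n := by simpa using Finset.card_le_univ (Finset.univ.filter fun j => M.col j ≠ 0)
  have hpow : q * q ^ (δ + k - 1) = q ^ δ * q ^ k := by
    rw [← pow_succ', ← pow_add]; congr 1; omega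
  have hcard : (Finset.univ.erase (0 : Fin k → F)).card = q ^ k - 1 := by
    rw [Finset.card_erase_of_mem (Finset.mem_univ _), Finset.card_univ, Fintype.card_fun,
      Fintype.card_fin]
  have hsum : ∑ c : Fin k → F, hammingNorm (Matrix.vecMul c M) =
      ∑ c ∈ Finset.univ.erase (0 : Fin k → F), hammingNorm (Matrix.vecMul c M) := by
    rw [← Finset.add_sum_erase _ _ (Finset.mem_univ (0 : Fin k → F))]
    simp
  have hle : ∀ c ∈ Finset.univ.erase (0 : Fin k → F),
      q ^ (δ + k - 1) ≤ hammingNorm (Matrix.vecMul c M) :=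
    fun c hc => hM c (Finset.ne_of_mem_erase hc)
  have hlow := Finset.sum_le_sum hle
  rw [Finset.sum_const, hcard, smul_eq_mul, ← hsum] at hlow
  -- The `Z` nonzero columns number at most `n`, so the total weight cannot exceed the lower bound
  -- `hlow`. Equality then forces both `Z = n` and constant weight.
  have hup : q * ∑ c : Fin k → F, hammingNorm (Matrix.vecMul c M) ≤
      q * ((q ^ k - 1) * q ^ (δ + k - 1)) := by
    calc _ = Z * ((q - 1) * q ^ k) := hs
      _ ≤ n * ((q - 1) * q ^ k) := Nat.mul_le_mul_right _ hZ
      _ = (n * (q - 1)) * q ^ k := by ring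
      _ = (q ^ k - 1) * (q * q ^ (δ + k - 1)) := by rw [hn, hpow]; ring
      _ = _ := by ring
  have heq : ∑ c : Fin k → F, hammingNorm (Matrix.vecMul c M) =
      (q ^ k - 1) * q ^ (δ + k - 1) :=
    le_antisymm (Nat.le_of_mul_le_mul_left hup (by omega)) hlow
  constructor
  · have hZn : Z = n := by
      have h1 : Z * ((q - 1) * q ^ k) = n * ((q - 1) * q ^ k) := by
        rw [← hs, heq]
        calc _ = (q ^ k - 1) * (q * q ^ (δ + k - 1)) := by ring
          _ = (n * (q - 1)) * q ^ k := by rw [hn, hpow]; ring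
          _ = _ := by ring
      exact Nat.eq_of_mul_eq_mul_right (Nat.mul_pos (by omega) (by positivity)) h1
    have : (Finset.univ.filter fun j => M.col j ≠ 0) = Finset.univ := by
      apply Finset.eq_univ_of_card
      rw [← hZdef, hZn, Fintype.card_fin]
    intro j
    have := this ▸ Finset.mem_univ j
    exact (Finset.mem_filter.mp this).2
  · rw [hsum] at heq
    have h2 : ∑ c ∈ Finset.univ.erase (0 : Fin k → F), q ^ (δ + k - 1) =
        ∑ c ∈ Finset.univ.erase (0 : Fin k → F), hammingNorm (Matrix.vecMul c M) := by
      rw [heq, Finset.sum_const, hcard, smul_eq_mul]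
    intro c hc
    exact ((Finset.sum_eq_sum_iff_of_le hle).mp h2 c
      (Finset.mem_erase.mpr ⟨hc, Finset.mem_univ _⟩)).symm

/-- If the translates of a code without zero coordinates have at least the average weight,
then they have exactly the average weight. -/
theorem hammingNorm_eq_of_forall_vecMul_add_le {k n A : ℕ}
    (hA : n * (Fintype.card F - 1) = Fintype.card F * A) (M : Matrix (Fin k) (Fin n) F)
    (hM : ∀ j, M.col j ≠ 0) (w : Fin n → F)
    (hw : ∀ c, A ≤ hammingNorm (Matrix.vecMul c M + w)) : hammingNorm w = A := by
  have hs := card_mul_sum_hammingNorm_vecMul_add M hM w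
  rw [← mul_assoc, hA, mul_assoc] at hs
  have hs' := Nat.eq_of_mul_eq_mul_left Fintype.card_pos hs
  have h2 : ∑ _c : Fin k → F, A = ∑ c : Fin k → F, hammingNorm (Matrix.vecMul c M + w) := by
    rw [hs', Finset.sum_const, Finset.card_univ, Fintype.card_fun, Fintype.card_fin, smul_eq_mul,
      mul_comm]
  have := (Finset.sum_eq_sum_iff_of_le fun c _ => hw c).mp h2 0 (Finset.mem_univ _)
  simpa using this.symm

end Counting

/-! ### Codewords, their coefficient vectors and delay-freeness -/

section Codes

variable {F : Type*} [Field F] {n k : ℕ}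

theorem mem_codeOf_iff {G : Matrix (Fin k) (Fin n) F[X]} {v : Fin n → F[X]} :
    v ∈ codeOf G ↔ ∃ u, Matrix.vecMul u G = v := by
  rw [codeOf, ← range_vecMulLinear]
  rfl

theorem coeffVec_vecMul (G : Matrix (Fin k) (Fin n) F[X]) (u : Fin k → F[X]) (t : ℕ) :
    coeffVec (Matrix.vecMul u G) t = ∑ p ∈ Finset.HasAntidiagonal.antidiagonal t,
      Matrix.vecMul (fun r => (u r).coeff p.1) (coeffMatrix G p.2) := by
  ext c
  simp only [coeffVec, Matrix.vecMul, dotProduct, finsetSum_coeff, coeff_mul, Finset.sum_apply,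
    coeffMatrix, Matrix.map_apply]
  exact Finset.sum_comm

theorem coeffVec_vecMul_zero (G : Matrix (Fin k) (Fin n) F[X]) (u : Fin k → F[X]) :
    coeffVec (Matrix.vecMul u G) 0 = Matrix.vecMul (fun r => (u r).coeff 0) (coeffMatrix G 0) := by
  rw [coeffVec_vecMul]
  simp

theorem coeffVec_add (v w : Fin n → F[X]) (t : ℕ) :
    coeffVec (v + w) t = coeffVec v t + coeffVec w t := by
  ext c
  simp [coeffVec]

theorem coeffVec_X_pow_smul_add (v : Fin n → F[X]) (s t : ℕ) :
    coeffVec (((X : F[X]) ^ s) • v) (t + s) = coeffVec v t := by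
  ext c
  simp [coeffVec, coeff_X_pow_mul]

theorem coeffVec_X_pow_smul_of_lt (v : Fin n → F[X]) {s t : ℕ} (h : t < s) :
    coeffVec (((X : F[X]) ^ s) • v) t = 0 := by
  ext c
  simp [coeffVec, coeff_X_pow_mul', h.not_ge]

theorem coeffVec_map_C_vecMul_zero (G : Matrix (Fin k) (Fin n) F[X]) (a : Fin k → F) :
    coeffVec (Matrix.vecMul (fun r => C (a r)) G) 0 = Matrix.vecMul a (coeffMatrix G 0) := by
  rw [coeffVec_vecMul_zero]
  simp

theorem exists_X_smul_eq_of_coeffVec_zero_eq_zero {G : Matrix (Fin k) (Fin n) F[X]}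
    (hG : LinearIndependent F (coeffMatrix G 0).row) {v : Fin n → F[X]} (hv : v ∈ codeOf G)
    (h0 : coeffVec v 0 = 0) : ∃ w ∈ codeOf G, (X : F[X]) • w = v := by
  obtain ⟨u, rfl⟩ := mem_codeOf_iff.mp hv
  rw [coeffVec_vecMul_zero] at h0
  have hu : (fun r => (u r).coeff 0) = 0 :=
    Matrix.vecMul_injective_iff.mpr hG (by simpa using h0)
  have hdvd : ∀ r, ∃ u', u r = X * u' := fun r => X_dvd_iff.mpr (congrFun hu r)
  choose u' hu' using hdvd
  refine ⟨_, mem_codeOf_iff.mpr ⟨u', rfl⟩, ?_⟩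
  rw [← Matrix.smul_vecMul]
  congr 1
  ext1 r
  simp [hu']

/-- Column distances only see words with `v_0 ≠ 0`; dividing out the largest power of `z` brings an
arbitrary nonzero word to this form inside the code. -/
theorem exists_X_pow_smul_eq {G : Matrix (Fin k) (Fin n) F[X]}
    (hG : LinearIndependent F (coeffMatrix G 0).row) {v : Fin n → F[X]} (hv : v ∈ codeOf G)
    (hv0 : v ≠ 0) : ∃ s, ∃ w ∈ codeOf G, coeffVec w 0 ≠ 0 ∧ (X : F[X]) ^ s • w = v := by
  classical
  have hex : ∃ t, coeffVec v t ≠ 0 := by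
    by_contra! h
    apply hv0
    ext c t
    exact congrFun (h t) c
  have key : ∀ s, (∀ t < s, coeffVec v t = 0) → ∃ w ∈ codeOf G, (X : F[X]) ^ s • w = v := by
    intro s
    induction s with
    | zero => exact fun _ => ⟨v, hv, by simp⟩
    | succ s ih =>
      intro hs
      obtain ⟨w, hw, hwv⟩ := ih fun t ht => hs t (by omega)
      have h0 : coeffVec w 0 = 0 := by
        rw [← coeffVec_X_pow_smul_add w s 0, hwv]
        exact hs _ (by omega)
      obtain ⟨w', hw', rfl⟩ := exists_X_smul_eq_of_coeffVec_zero_eq_zero hG hw h0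
      exact ⟨w', hw', by rw [← hwv, pow_succ, mul_smul]⟩
  obtain ⟨w, hw, hwv⟩ := key (Nat.find hex) fun t ht => not_not.mp (Nat.find_min hex ht)
  refine ⟨_, w, hw, ?_, hwv⟩
  rw [← coeffVec_X_pow_smul_add w (Nat.find hex) 0, hwv, zero_add]
  exact Nat.find_spec hex

/-- The rows of a generator matrix of a delay-free code have nonzero constant coefficient. -/
theorem coeffVec_row_zero_ne_zero {C : Submodule F[X] (Fin n → F[X])} (hC : IsDelayFree C k)
    {G : Matrix (Fin k) (Fin n) F[X]} (hG : IsGeneratorMatrix G C) (r : Fin k) :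
    coeffVec (G.row r) 0 ≠ 0 := by
  intro h0
  obtain ⟨G', ⟨-, rfl⟩, hG'⟩ := hC
  have hr : G.row r ∈ codeOf G' := hG.2 ▸ Submodule.subset_span ⟨r, rfl⟩
  obtain ⟨w, hw, hwr⟩ := exists_X_smul_eq_of_coeffVec_zero_eq_zero hG' hr h0
  rw [← hG.2] at hw
  obtain ⟨u, rfl⟩ := mem_codeOf_iff.mp hw
  -- Independence of the rows would give `z u = e_r`, and the constant coefficients would read `0 =
  -- 1`.
  have h1 : Matrix.vecMul ((X : F[X]) • u) G = Matrix.vecMul (Pi.single r 1) G := by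
    rw [Matrix.smul_vecMul, hwr, Matrix.single_one_vecMul]
  have h2 := congrFun (Matrix.vecMul_injective_iff.mpr hG.1 h1) r
  have h3 := congrArg (fun p => coeff p 0) h2
  simp at h3

/-- The `k` row degrees of a minimal generator matrix add up to `δ`, so one is at most `⌊δ/k⌋`. This
caps the column distances of the code and of every rival. -/
theorem exists_mem_coeffVec_zero_ne_zero_of_rowDegree_le {C : Submodule F[X] (Fin n → F[X])}
    {δ : ℕ} (hk : 0 < k) (hC : IsConvCode C k δ) (hC' : IsDelayFree C k) :
    ∃ v ∈ C, coeffVec v 0 ≠ 0 ∧ ∀ t > δ / k, coeffVec v t = 0 := by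
  obtain ⟨-, G, ⟨hG, -⟩, hδ⟩ := hC
  have hr : ∃ r, rowDegree G r ≤ δ / k := by
    by_contra! h
    have h1 : ∑ _r : Fin k, (δ / k + 1) ≤ ∑ r, rowDegree G r :=
      Finset.sum_le_sum fun r _ => h r
    rw [Finset.sum_const, Finset.card_univ, Fintype.card_fin, smul_eq_mul] at h1
    have h2 := Nat.lt_mul_div_succ δ hk
    rw [externalDegree] at hδ
    omega
  obtain ⟨r, hr⟩ := hr
  refine ⟨G.row r, hG.2 ▸ Submodule.subset_span ⟨r, rfl⟩, coeffVec_row_zero_ne_zero hC' hG r, ?_⟩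
  intro t ht
  ext c
  refine coeff_eq_zero_of_natDegree_lt (lt_of_le_of_lt ?_ (lt_of_le_of_lt hr ht))
  exact Finset.le_sup (f := fun c => (G r c).natDegree) (Finset.mem_univ c)

/-! ### Truncated weights, distances and the optimality argument -/

section Distances

variable [DecidableEq F]

theorem truncWeight_succ (j : ℕ) (v : Fin n → F[X]) :
    truncWeight (j + 1) v = truncWeight j v + hammingNorm (coeffVec v (j + 1)) :=
  Finset.sum_range_succ _ _

theorem truncWeight_zero (v : Fin n → F[X]) :
    truncWeight 0 v = hammingNorm (coeffVec v 0) := by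
  simp [truncWeight]

theorem truncWeight_mono (v : Fin n → F[X]) {i j : ℕ} (h : i ≤ j) :
    truncWeight i v ≤ truncWeight j v :=
  Finset.sum_le_sum_of_subset (Finset.range_subset_range.mpr (by omega))

theorem truncWeight_eq_of_coeffVec_eq_zero {v : Fin n → F[X]} {m j : ℕ} (hmj : m ≤ j)
    (h : ∀ t > m, coeffVec v t = 0) : truncWeight j v = truncWeight m v := by
  symm
  refine Finset.sum_subset (Finset.range_subset_range.mpr (by omega)) fun t _ ht => ?_
  rw [h t (by simpa using ht), hammingNorm_zero]

theorem exists_weight_eq_truncWeight (v : Fin n → F[X]) :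
    ∃ d, ∀ j ≥ d, weight v = truncWeight j v := by
  refine ⟨Finset.univ.sup fun c => (v c).natDegree, fun j hj => ?_⟩
  refine finsum_eq_finsetSum_of_support_subset _ fun t ht => ?_
  by_contra hlt
  apply ht
  have : coeffVec v t = 0 := by
    ext c
    refine coeff_eq_zero_of_natDegree_lt (lt_of_le_of_lt
      (Finset.le_sup (f := fun c => (v c).natDegree) (Finset.mem_univ c)) ?_)
    simp only [Finset.coe_range, Set.mem_Iio] at hlt
    omega
  simp [this]

theorem truncWeight_le_weight (j : ℕ) (v : Fin n → F[X]) : truncWeight j v ≤ weight v := by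
  obtain ⟨d, hd⟩ := exists_weight_eq_truncWeight v
  rw [hd (max d j) (le_max_left _ _)]
  exact truncWeight_mono v (le_max_right _ _)

theorem weight_eq_truncWeight_of_coeffVec_eq_zero {v : Fin n → F[X]} {m : ℕ}
    (h : ∀ t > m, coeffVec v t = 0) : weight v = truncWeight m v := by
  obtain ⟨d, hd⟩ := exists_weight_eq_truncWeight v
  rw [hd (max d m) (le_max_left _ _), truncWeight_eq_of_coeffVec_eq_zero (le_max_right _ _) h]

theorem truncWeight_le_truncWeight_X_pow_smul (j s : ℕ) (v : Fin n → F[X]) :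
    truncWeight j v ≤ truncWeight (j + s) ((X : F[X]) ^ s • v) := by
  rw [truncWeight, truncWeight, show j + s + 1 = s + (j + 1) by omega,
    Finset.sum_range_add _ s]
  refine (Finset.sum_le_sum fun t _ => ?_).trans (Nat.le_add_left _ _)
  rw [add_comm s t, coeffVec_X_pow_smul_add]

/-- A codeword delayed by `j + 1` leaves the past of `v` intact and translates `v_{j+1}` by an
element of the row space of `G_0`; this feeds the averaging over translates. -/
theorem truncWeight_add_X_pow_smul (j : ℕ) (v w : Fin n → F[X]) :
    truncWeight (j + 1) (v + (X : F[X]) ^ (j + 1) • w) =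
      truncWeight j v + hammingNorm (coeffVec w 0 + coeffVec v (j + 1)) := by
  rw [truncWeight_succ]
  congr 1
  · refine Finset.sum_congr rfl fun t ht => ?_
    rw [coeffVec_add, coeffVec_X_pow_smul_of_lt w (by simpa using ht), add_zero]
  · have := coeffVec_X_pow_smul_add w (j + 1) 0
    rw [zero_add] at this
    rw [coeffVec_add, this, add_comm]

theorem columnDistance_le {C : Submodule F[X] (Fin n → F[X])} {v : Fin n → F[X]} (hv : v ∈ C)
    (hv0 : coeffVec v 0 ≠ 0) (j : ℕ) : columnDistance C j ≤ truncWeight j v :=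
  Nat.sInf_le ⟨v, hv, hv0, rfl⟩

theorem columnDistance_eq {C : Submodule F[X] (Fin n → F[X])} {j d : ℕ}
    (hle : ∀ v ∈ C, coeffVec v 0 ≠ 0 → d ≤ truncWeight j v)
    (hex : ∃ v ∈ C, coeffVec v 0 ≠ 0 ∧ truncWeight j v = d) : columnDistance C j = d := by
  refine IsLeast.csInf_eq ⟨hex, ?_⟩
  rintro w ⟨v, hv, hv0, rfl⟩
  exact hle v hv hv0

/-- If the free distance of a delay-free code is attained within the window `{0, …, m}`, it is a
column distance. -/
theorem freeDistance_eq {G : Matrix (Fin k) (Fin n) F[X]}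
    (hG : LinearIndependent F (coeffMatrix G 0).row) {m d : ℕ}
    (hle : ∀ v ∈ codeOf G, coeffVec v 0 ≠ 0 → d ≤ truncWeight m v)
    (hex : ∃ v ∈ codeOf G, coeffVec v 0 ≠ 0 ∧ truncWeight m v = d ∧ ∀ t > m, coeffVec v t = 0) :
    freeDistance (codeOf G) = d := by
  obtain ⟨v, hv, hv0, hvd, hvm⟩ := hex
  refine IsLeast.csInf_eq ⟨⟨v, hv, ?_, ?_⟩, ?_⟩
  · rintro rfl
    exact hv0 (by ext c; simp [coeffVec])
  · rw [weight_eq_truncWeight_of_coeffVec_eq_zero hvm, hvd]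
  · rintro w ⟨v, hv, hv0, rfl⟩
    obtain ⟨s, w, hw, hw0, rfl⟩ := exists_X_pow_smul_eq hG hv hv0
    exact (hle w hw hw0).trans
      ((truncWeight_le_truncWeight_X_pow_smul m s w).trans (truncWeight_le_weight _ _))

variable [Fintype F]

/-- The Plotkin-type averaging bound for the column distances, with its equality case. -/
theorem truncWeight_eq_of_le {δ m : ℕ} (hk : 0 < k)
    (hn : n * (Fintype.card F - 1) = Fintype.card F ^ δ * (Fintype.card F ^ k - 1))
    (hm : 0 < m → 0 < δ) {G : Matrix (Fin k) (Fin n) F[X]}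
    (hG : LinearIndependent F (coeffMatrix G 0).row)
    (hle : ∀ i ≤ m, ∀ v ∈ codeOf G, coeffVec v 0 ≠ 0 → Fintype.card F ^ (δ + k - 1) +
      i * (Fintype.card F ^ (δ + k - 1) - Fintype.card F ^ (δ - 1)) ≤ truncWeight i v) :
    ∀ i ≤ m, ∀ v ∈ codeOf G, coeffVec v 0 ≠ 0 → truncWeight i v = Fintype.card F ^ (δ + k - 1) +
      i * (Fintype.card F ^ (δ + k - 1) - Fintype.card F ^ (δ - 1)) := by
  have hinj := Matrix.vecMul_injective_iff.mpr hG
  obtain ⟨hcol, hconst⟩ := hammingNorm_vecMul_eq_of_le hk hn (coeffMatrix G 0) fun c hc => by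
    have h0 : coeffVec (Matrix.vecMul (fun r => C (c r)) G) 0 ≠ 0 := by
      rw [coeffVec_map_C_vecMul_zero]
      intro h
      exact hc (hinj (by simpa using h))
    have := hle 0 (Nat.zero_le _) _ (mem_codeOf_iff.mpr ⟨_, rfl⟩) h0
    rwa [truncWeight_zero, coeffVec_map_C_vecMul_zero, zero_mul, add_zero] at this
  intro i
  induction i with
  | zero =>
    intro _ v hv hv0
    obtain ⟨u, rfl⟩ := mem_codeOf_iff.mp hv
    rw [truncWeight_zero, coeffVec_vecMul_zero, zero_mul, add_zero]
    apply hconst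
    intro h
    apply hv0
    rw [coeffVec_vecMul_zero, h, Matrix.zero_vecMul]
  | succ i ih =>
    intro hi v hv hv0
    have hδ : 0 < δ := hm (by omega)
    -- The average weight of a translate; `δ > 0` is needed because `δ - 1` is truncated.
    have hA : n * (Fintype.card F - 1) = Fintype.card F *
        (Fintype.card F ^ (δ + k - 1) - Fintype.card F ^ (δ - 1)) := by
      rw [hn, Nat.mul_sub, Nat.mul_sub, ← pow_succ', ← pow_succ', ← pow_add, mul_one]
      congr 2 <;> omega
    have ihv := ih (by omega) v hv hv0
    rw [truncWeight_succ, ihv, add_mul, one_mul, add_assoc]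
    congr 2
    refine hammingNorm_eq_of_forall_vecMul_add_le hA (coeffMatrix G 0) hcol _ fun c => ?_
    have hmem : v + (X : F[X]) ^ (i + 1) • Matrix.vecMul (fun r => C (c r)) G ∈ codeOf G :=
      add_mem hv (Submodule.smul_mem _ _ (mem_codeOf_iff.mpr ⟨_, rfl⟩))
    have h := hle (i + 1) hi _ hmem (by
      rwa [coeffVec_add, coeffVec_X_pow_smul_of_lt _ (Nat.succ_pos i), add_zero])
    rw [truncWeight_add_X_pow_smul, ihv, coeffVec_map_C_vecMul_zero] at h
    rw [add_mul, one_mul] at h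
    omega

/-- A code whose column distances are `q^(δ+k-1) + min(j, ⌊δ/k⌋) (q^(δ+k-1) - q^(δ-1))` has
optimal column distances. -/
theorem hasOptimalColumnDistances_of_columnDistance_eq {δ : ℕ} (hk : 0 < k)
    (hn : n * (Fintype.card F - 1) = Fintype.card F ^ δ * (Fintype.card F ^ k - 1))
    {C : Submodule F[X] (Fin n → F[X])} (hC : IsConvCode C k δ) (hdf : IsDelayFree C k)
    (hd : ∀ j, columnDistance C j = Fintype.card F ^ (δ + k - 1) +
      min j (δ / k) * (Fintype.card F ^ (δ + k - 1) - Fintype.card F ^ (δ - 1))) :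
    HasOptimalColumnDistances C k δ := by
  refine ⟨hC, hdf, ?_⟩
  rintro ⟨C', hC', hdf', j, hlt, heq⟩
  obtain ⟨v, hv, hv0, hvm⟩ := exists_mem_coeffVec_zero_ne_zero_of_rowDegree_le hk hC' hdf'
  obtain ⟨G, ⟨-, rfl⟩, hG⟩ := hdf'
  -- Up to the first difference `j` the rival meets the lower bounds. If `δ = 0` the window is
  -- `{0}`, so the truncated exponent `δ - 1` plays no role.
  have hall := truncWeight_eq_of_le (m := min j (δ / k)) hk hn
    (fun h => Nat.pos_of_ne_zero fun h0 => by simp [h0] at h) hG fun i hi w hw hw0 => by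
      refine le_trans ?_ (columnDistance_le hw hw0 i)
      have hdi := hd i
      rw [min_eq_left (hi.trans (min_le_right _ _))] at hdi
      rw [← hdi]
      rcases (hi.trans (min_le_left _ _)).lt_or_eq with h | rfl
      · exact (heq i h).ge
      · exact hlt.le
  have hvj := columnDistance_le hv hv0 j
  have h1 : truncWeight j v = truncWeight (min j (δ / k)) v := by
    rcases le_total j (δ / k) with h | h
    · rw [min_eq_left h]
    · rw [min_eq_right h, truncWeight_eq_of_coeffVec_eq_zero h hvm]
  rw [h1, hall _ le_rfl v hv hv0, ← hd] at hvj
  omega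

end Distances

end Codes

/-! ### Leading row coefficients and maximal minors -/

section RowReduced

variable {F : Type*} [Field F] {n k : ℕ}

theorem coeff_prod_of_natDegree_le_apply {ι : Type*} (s : Finset ι) (f : ι → F[X]) (d : ι → ℕ)
    (h : ∀ i ∈ s, (f i).natDegree ≤ d i) :
    (∏ i ∈ s, f i).coeff (∑ i ∈ s, d i) = ∏ i ∈ s, (f i).coeff (d i) := by
  classical
  induction s using Finset.induction_on with
  | empty => simp
  | insert a s ha ih =>
    rw [Finset.prod_insert ha, Finset.sum_insert ha, Finset.prod_insert ha,
      coeff_mul_add_eq_of_natDegree_le (h a (Finset.mem_insert_self _ _)) ?_,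
      ih fun i hi => h i (Finset.mem_insert_of_mem hi)]
    exact (natDegree_prod_le _ _).trans
      (Finset.sum_le_sum fun i hi => h i (Finset.mem_insert_of_mem hi))

theorem natDegree_det_le_of_forall_le (M : Matrix (Fin k) (Fin k) F[X]) (d : Fin k → ℕ)
    (h : ∀ i j, (M i j).natDegree ≤ d i) : M.det.natDegree ≤ ∑ i, d i := by
  rw [← Matrix.det_transpose, Matrix.det_apply]
  refine natDegree_sum_le_of_forall_le _ _ fun τ _ => (natDegree_smul_le _ _).trans ?_
  exact (natDegree_prod_le _ _).trans (Finset.sum_le_sum fun i _ => h i _)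

/-- Each Leibniz term takes one entry per row, so only the coefficients of degree `d i` contribute
in degree `∑ d i`. -/
theorem coeff_det_of_forall_natDegree_le (M : Matrix (Fin k) (Fin k) F[X]) (d : Fin k → ℕ)
    (h : ∀ i j, (M i j).natDegree ≤ d i) :
    M.det.coeff (∑ i, d i) = (Matrix.of fun i j => (M i j).coeff (d i)).det := by
  rw [← Matrix.det_transpose, Matrix.det_apply, ← Matrix.det_transpose (Matrix.of _),
    Matrix.det_apply, finsetSum_coeff]
  refine Finset.sum_congr rfl fun τ _ => ?_
  rw [coeff_smul]
  exact congrArg _ (coeff_prod_of_natDegree_le_apply _ _ _ fun i _ => h i (τ i))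

/-- A matrix with linearly independent rows has a nonsingular maximal submatrix. -/
theorem exists_orderEmbedding_det_submatrix_ne_zero (L : Matrix (Fin k) (Fin n) F)
    (hL : LinearIndependent F L.row) : ∃ f : Fin k ↪o Fin n, (L.submatrix id f).det ≠ 0 := by
  classical
  have hrank : Module.finrank F (Submodule.span F (Set.range L.col)) = k := by
    rw [← Matrix.rank_eq_finrank_span_cols]
    simpa using hL.rank_matrix
  have hex := Submodule.exists_fun_fin_finrank_span_eq F (Set.range L.col)
  rw [hrank] at hex
  obtain ⟨f, hf, -, hli⟩ := hex
  choose g hg using hf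
  have hgL : L.col ∘ g = f := funext hg
  have hginj : Function.Injective g := fun a b hab =>
    hli.injective (by rw [← hg a, ← hg b, hab])
  -- The independent columns come in arbitrary order, whereas minors use increasing choices: list
  -- them increasingly by `e` and reindex by `τ`.
  have hcard : (Finset.univ.map ⟨g, hginj⟩).card = k := by simp
  let e := (Finset.univ.map ⟨g, hginj⟩).orderEmbOfFin hcard
  have he : ∀ i, ∃ a, g a = e i := fun i => by
    obtain ⟨a, -, ha⟩ := Finset.mem_map.mp (Finset.orderEmbOfFin_mem _ hcard i)
    exact ⟨a, ha⟩
  choose τ hτ using he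
  have hτinj : Function.Injective τ := fun a b hab =>
    e.injective (by rw [← hτ a, ← hτ b, hab])
  refine ⟨e, ?_⟩
  have hli' : LinearIndependent F (L.submatrix id e).col := by
    have h := hli.comp τ hτinj
    rw [← hgL] at h
    have heq : (L.submatrix id e).col = (L.col ∘ g) ∘ τ := by
      ext i r
      simp [hτ, Matrix.col_apply]
    rw [heq]
    exact h
  exact ((Matrix.isUnit_iff_isUnit_det _).mp
    (Matrix.linearIndependent_cols_iff_isUnit.mp hli')).ne_zero

end RowReduced

/-! ### Parity-check matrices from a right inverse -/

section NonCatastrophic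

variable {F : Type*} [Field F] {n k : ℕ}

theorem linearIndependent_row_of_mul_eq_one {R : Type*} [CommRing R] {G : Matrix (Fin k) (Fin n) R}
    {P : Matrix (Fin n) (Fin k) R} (hP : G * P = 1) : LinearIndependent R G.row := by
  rw [← Matrix.vecMul_injective_iff]
  refine Function.LeftInverse.injective (g := fun v => Matrix.vecMul v P) fun u => ?_
  simp only [Matrix.vecMul_vecMul, hP, Matrix.vecMul_one]

/-- A code with a right invertible generator matrix has a parity-check matrix. -/
theorem isNonCatastrophic_of_mul_eq_one {G : Matrix (Fin k) (Fin n) F[X]}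
    {P : Matrix (Fin n) (Fin k) F[X]} (hP : G * P = 1) : IsNonCatastrophic (codeOf G) k := by
  have hsurj : Function.Surjective G.mulVecLin := by
    refine fun y => ⟨P.mulVec y, ?_⟩
    rw [Matrix.mulVecLin_apply, Matrix.mulVec_mulVec, hP, Matrix.one_mulVec]
  have hrank : Module.finrank F[X] (LinearMap.ker G.mulVecLin) = n - k := by
    have := (LinearMap.ker G.mulVecLin).finrank_quotient_add_finrank
    rw [(G.mulVecLin.quotKerEquivOfSurjective hsurj).finrank_eq, Module.finrank_fintype_fun_eq_card, Module.finrank_fintype_fun_eq_card,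
      Fintype.card_fin, Fintype.card_fin] at this
    omega
  let b := Module.finBasisOfFinrankEq F[X] (LinearMap.ker G.mulVecLin) hrank
  refine ⟨fun i => (b i : Fin n → F[X]), ?_, fun v => ?_⟩
  · exact b.linearIndependent.map' (LinearMap.ker G.mulVecLin).subtype (Submodule.ker_subtype _)
  have hb : ∀ i, G.mulVec (b i : Fin n → F[X]) = 0 := fun i => (b i).2
  constructor
  · intro hv
    obtain ⟨u, rfl⟩ := mem_codeOf_iff.mp hv
    ext1 i
    change (b i : Fin n → F[X]) ⬝ᵥ Matrix.vecMul u G = 0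
    rw [dotProduct_comm, ← Matrix.dotProduct_mulVec, hb, dotProduct_zero]
  · intro hv
    have hker : ∀ w, G.mulVec w = 0 → v ⬝ᵥ w = 0 := by
      intro w hw
      have hw' : (⟨w, hw⟩ : LinearMap.ker G.mulVecLin) ∈ Submodule.span F[X] (Set.range b) :=
        b.span_eq ▸ Submodule.mem_top
      obtain ⟨a, ha⟩ := (Submodule.mem_span_range_iff_exists_fun _).mp hw'
      have ha' : ∑ i, a i • (b i : Fin n → F[X]) = w := by
        simpa using congrArg Subtype.val ha
      rw [← ha', dotProduct_sum]
      refine Finset.sum_eq_zero fun i _ => ?_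
      rw [dotProduct_smul, dotProduct_comm]
      have : (b i : Fin n → F[X]) ⬝ᵥ v = 0 := congrFun hv i
      rw [this, smul_zero]
    refine mem_codeOf_iff.mpr ⟨Matrix.vecMul v P, ?_⟩
    ext1 c
    -- The columns of `1 - P G` lie in the kernel of `G`, to which `v` is orthogonal; hence `v = (v
    -- P) G`.
    obtain ⟨Q, hQ⟩ : ∃ Q : Matrix (Fin n) (Fin n) F[X], Q = 1 - P * G := ⟨_, rfl⟩
    have hmul : G * Q = 0 := by
      rw [hQ, Matrix.mul_sub, ← Matrix.mul_assoc, hP, Matrix.mul_one, Matrix.one_mul, sub_self]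
    have h1 : Matrix.vecMul v Q c = 0 := by
      refine hker (fun s => Q s c) ?_
      ext1 r
      have h := congrFun (congrFun hmul r) c
      rwa [Matrix.mul_apply] at h
    rw [hQ, Matrix.vecMul_sub, Matrix.vecMul_one, ← Matrix.vecMul_vecMul] at h1
    exact (sub_eq_zero.mp h1).symm

end NonCatastrophic

/-! ### Simplex matrices -/

section Simplex

variable {F : Type*} [Field F] {m N : ℕ} {S : Matrix (Fin m) (Fin N) F}

theorem IsSimplexMatrix.exists_smul_col_eq (hS : IsSimplexMatrix S) {v : Fin m → F} (hv : v ≠ 0) :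
    ∃ (a : Fˣ) (j : Fin N), a • S.col j = v := by
  obtain ⟨j, hj, -⟩ := hS.2 v hv
  obtain ⟨a, ha⟩ := Submodule.span_singleton_eq_span_singleton.mp hj
  exact ⟨a, j, ha⟩

theorem IsSimplexMatrix.eq_of_smul_col_eq (hS : IsSimplexMatrix S) {a b : Fˣ} {i j : Fin N}
    (h : a • S.col i = b • S.col j) : a = b ∧ i = j := by
  have hij : i = j := by
    refine (hS.2 (S.col j) (hS.1 j)).unique ?_ rfl
    refine Submodule.span_singleton_eq_span_singleton.mpr ⟨b⁻¹ * a, ?_⟩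
    rw [mul_smul, h, inv_smul_smul]
  subst hij
  refine ⟨?_, rfl⟩
  obtain ⟨r, hr⟩ := Function.ne_iff.mp (hS.1 i)
  have := congrFun h r
  simp only [Pi.smul_apply, Units.smul_def, smul_eq_mul] at this
  exact Units.ext (mul_right_cancel₀ hr this)

variable [Fintype F] [DecidableEq F]

/-- A scaling-invariant set of nonzero vectors is counted by the columns of a simplex matrix. -/
theorem IsSimplexMatrix.card_filter_eq (hS : IsSimplexMatrix S) (P : (Fin m → F) → Prop)
    [DecidablePred P] (h0 : ∀ v, P v → v ≠ 0) (hP : ∀ (a : Fˣ) v, P (a • v) ↔ P v) :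
    (Finset.univ.filter P).card =
      (Fintype.card F - 1) * (Finset.univ.filter fun j => P (S.col j)).card := by
  rw [← Fintype.card_units, ← Finset.card_univ, ← Finset.card_product]
  symm
  refine Finset.card_bij (fun p _ => p.1 • S.col p.2) ?_ ?_ ?_
  · rintro ⟨a, j⟩ h
    simpa [hP] using h
  · rintro ⟨a, i⟩ _ ⟨b, j⟩ _ h
    obtain ⟨rfl, rfl⟩ := hS.eq_of_smul_col_eq h
    rfl
  · intro v hv
    have hPv := (Finset.mem_filter.mp hv).2
    obtain ⟨a, j, rfl⟩ := hS.exists_smul_col_eq (h0 v hPv)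
    exact ⟨(a, j), by simpa [hP] using hPv, rfl⟩

theorem IsSimplexMatrix.card_sub_one_mul (hS : IsSimplexMatrix S) :
    (Fintype.card F - 1) * N = Fintype.card F ^ m - 1 := by
  have h := hS.card_filter_eq (fun v => v ≠ 0) (fun _ h => h) (fun a v => (smul_ne_zero_iff_ne a))
  rw [Finset.filter_true_of_mem (s := (Finset.univ : Finset (Fin N))) fun j _ => hS.1 j,
    Finset.filter_ne', Finset.card_erase_of_mem (Finset.mem_univ _)] at h
  simpa using h.symm

/-- The simplex code has constant weight. -/
theorem IsSimplexMatrix.card_dotProduct_col_ne_zero (hS : IsSimplexMatrix S) {a : Fin m → F}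
    (ha : a ≠ 0) :
    Fintype.card F * (Finset.univ.filter fun j => a ⬝ᵥ S.col j ≠ 0).card = Fintype.card F ^ m := by
  have hq : 1 < Fintype.card F := Fintype.one_lt_card
  have h := hS.card_filter_eq (fun v => v ⬝ᵥ a ≠ 0) (by rintro v h rfl; simp at h)
    (fun b v => by simp [Units.smul_def, smul_dotProduct])
  have h2 := card_mul_card_dotProduct_add_ne ha 0
  simp only [add_zero] at h2
  rw [h, Fintype.card_fin] at h2
  simp only [dotProduct_comm a]
  refine Nat.eq_of_mul_eq_mul_left (show 0 < Fintype.card F - 1 by omega) ?_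
  rw [← h2]
  ring

end Simplex

/-! ### The MacDonald matrix and its two weights -/

section MacDonald

variable {F : Type*} {k δ L N : ℕ}

theorem macDonaldBlocks_castAdd (S : Matrix (Fin k) (Fin N) F) (x : Fin L → Fin δ → F)
    (i : Fin k) (b : Fin L) (j : Fin N) :
    macDonaldBlocks S x (Fin.castAdd δ i) (finProdFinEquiv (b, j)) = S i j := by
  simp [macDonaldBlocks]

theorem macDonaldBlocks_natAdd (S : Matrix (Fin k) (Fin N) F) (x : Fin L → Fin δ → F)
    (i : Fin δ) (b : Fin L) (j : Fin N) :
    macDonaldBlocks S x (Fin.natAdd k i) (finProdFinEquiv (b, j)) = x b i := by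
  simp [macDonaldBlocks]

variable [Field F]

theorem vecMul_macDonaldBlocks (S : Matrix (Fin k) (Fin N) F) (x : Fin L → Fin δ → F)
    (a : Fin (k + δ) → F) (b : Fin L) (j : Fin N) :
    Matrix.vecMul a (macDonaldBlocks S x) (finProdFinEquiv (b, j)) =
      (fun i => a (Fin.natAdd k i)) ⬝ᵥ x b + (fun i => a (Fin.castAdd δ i)) ⬝ᵥ S.col j := by
  simp only [Matrix.vecMul, dotProduct, Fin.sum_univ_add, macDonaldBlocks_castAdd,
    macDonaldBlocks_natAdd, Matrix.col_apply]
  rw [add_comm]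

section Weights

variable [Fintype F] [DecidableEq F]

theorem hammingNorm_vecMul_macDonaldBlocks (S : Matrix (Fin k) (Fin N) F)
    (x : Fin L ≃ (Fin δ → F)) (a : Fin (k + δ) → F) :
    hammingNorm (Matrix.vecMul a (macDonaldBlocks S x)) =
      ∑ j, (Finset.univ.filter fun y : Fin δ → F => y ⬝ᵥ (fun i => a (Fin.natAdd k i)) +
        (fun i => a (Fin.castAdd δ i)) ⬝ᵥ S.col j ≠ 0).card := by
  simp only [hammingNorm, Finset.card_filter]
  rw [← finProdFinEquiv.sum_comp, Fintype.sum_prod_type, Finset.sum_comm]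
  refine Finset.sum_congr rfl fun j _ => ?_
  rw [← x.sum_comp]
  refine Finset.sum_congr rfl fun b _ => ?_
  rw [vecMul_macDonaldBlocks, dotProduct_comm (x b)]

/-- Each column of `S` contributes the nonzeros of a nonconstant affine function on `F^δ`, and there
are `N = (q^k - 1)/(q - 1)` columns. -/
theorem hammingNorm_vecMul_macDonaldBlocks_of_natAdd_ne_zero {S : Matrix (Fin k) (Fin N) F}
    (hS : IsSimplexMatrix S) (x : Fin L ≃ (Fin δ → F)) {a : Fin (k + δ) → F}
    (ha : ∃ i, a (Fin.natAdd k i) ≠ 0) :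
    hammingNorm (Matrix.vecMul a (macDonaldBlocks S x)) =
      Fintype.card F ^ (δ + k - 1) - Fintype.card F ^ (δ - 1) := by
  have ha' : (fun i => a (Fin.natAdd k i)) ≠ 0 := Function.ne_iff.mpr ha
  have hδ : 0 < δ := ha.choose.pos
  refine Nat.eq_of_mul_eq_mul_left (Fintype.card_pos (α := F)) ?_
  rw [hammingNorm_vecMul_macDonaldBlocks, Finset.mul_sum,
    Finset.sum_congr rfl fun j _ => card_mul_card_dotProduct_add_ne ha' _]
  rw [Finset.sum_const, Finset.card_univ, Fintype.card_fin, Fintype.card_fin, smul_eq_mul,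
    ← mul_assoc, mul_comm N, hS.card_sub_one_mul, Nat.mul_sub, ← pow_succ', ← pow_succ',
    Nat.sub_mul, one_mul, ← pow_add]
  congr 2 <;> omega

/-- The word consists of `q^δ` copies of one nonzero simplex codeword. -/
theorem hammingNorm_vecMul_macDonaldBlocks_of_natAdd_eq_zero (hk : 0 < k)
    {S : Matrix (Fin k) (Fin N) F} (hS : IsSimplexMatrix S) (x : Fin L ≃ (Fin δ → F))
    {a : Fin (k + δ) → F} (ha0 : ∀ i, a (Fin.natAdd k i) = 0) (ha : a ≠ 0) :
    hammingNorm (Matrix.vecMul a (macDonaldBlocks S x)) = Fintype.card F ^ (δ + k - 1) := by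
  have ha' : (fun i => a (Fin.castAdd δ i)) ≠ 0 := by
    intro h
    apply ha
    ext p
    exact Fin.addCases (fun i => congrFun h i) ha0 p
  refine Nat.eq_of_mul_eq_mul_left (Fintype.card_pos (α := F)) ?_
  have h0 : (fun i => a (Fin.natAdd k i)) = 0 := funext ha0
  have hj : ∀ j, (Finset.univ.filter fun _ : Fin δ → F =>
      (fun i => a (Fin.castAdd δ i)) ⬝ᵥ S.col j ≠ 0).card =
      if (fun i => a (Fin.castAdd δ i)) ⬝ᵥ S.col j ≠ 0 then Fintype.card F ^ δ else 0 := by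
    intro j
    split_ifs with h
    · rw [Finset.filter_true_of_mem fun _ _ => h]
      simp
    · rw [Finset.filter_false_of_mem fun _ _ => h]
      simp
  rw [hammingNorm_vecMul_macDonaldBlocks, h0]
  simp only [dotProduct_zero, zero_add]
  rw [Finset.sum_congr rfl fun j _ => hj j, ← Finset.sum_filter, Finset.sum_const, smul_eq_mul,
    ← mul_assoc, hS.card_dotProduct_col_ne_zero ha', ← pow_add, ← pow_succ']
  congr 1
  omega

theorem linearIndependent_row_macDonaldBlocks (hk : 0 < k)
    {S : Matrix (Fin k) (Fin N) F} (hS : IsSimplexMatrix S) (x : Fin L ≃ (Fin δ → F)) :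
    LinearIndependent F (macDonaldBlocks S x).row := by
  have hq : 1 < Fintype.card F := Fintype.one_lt_card
  rw [← Matrix.vecMul_injective_iff]
  refine (injective_iff_map_eq_zero (Matrix.vecMulLinear (macDonaldBlocks S x))).mpr fun a h => ?_
  rw [Matrix.vecMulLinear_apply] at h
  by_contra ha
  by_cases h0 : ∀ i, a (Fin.natAdd k i) = 0
  · have := hammingNorm_vecMul_macDonaldBlocks_of_natAdd_eq_zero hk hS x h0 ha
    rw [h, hammingNorm_zero] at this
    exact (pow_pos (by omega) _).ne this
  · push Not at h0
    have hδ : 0 < δ := h0.choose.pos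
    have := hammingNorm_vecMul_macDonaldBlocks_of_natAdd_ne_zero hS x h0
    rw [h, hammingNorm_zero] at this
    have := Nat.pow_lt_pow_right hq (show δ - 1 < δ + k - 1 by omega)
    omega

end Weights

/-- The columns `(s_j, x_b)` together with representatives of the lines of `0 × F^δ`. -/
theorem isMacDonaldMatrix_macDonaldBlocks [Finite F] {S : Matrix (Fin k) (Fin N) F}
    (hS : IsSimplexMatrix S) (x : Fin L ≃ (Fin δ → F)) :
    IsMacDonaldMatrix (macDonaldBlocks S x) := by
  classical
  have := Fintype.ofFinite (Projectivization F (Fin δ → F))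
  let T : Fin (L * N) ⊕ Projectivization F (Fin δ → F) → Fin (k + δ) → F :=
    Sum.elim (macDonaldBlocks S x).col fun P => Fin.append 0 P.rep
  have hTl : ∀ b j i, T (.inl (finProdFinEquiv (b, j))) (Fin.castAdd δ i) = S i j :=
    fun b j i => macDonaldBlocks_castAdd S x i b j
  have hTl' : ∀ b j i, T (.inl (finProdFinEquiv (b, j))) (Fin.natAdd k i) = x b i :=
    fun b j i => macDonaldBlocks_natAdd S x i b j
  have hTr : ∀ P i, T (.inr P) (Fin.castAdd δ i) = 0 := fun P i => by simp [T]
  have hTr' : ∀ P i, T (.inr P) (Fin.natAdd k i) = P.rep i := fun P i => by simp [T]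
  have hleft : ∀ c, ∃ i, T (.inl c) (Fin.castAdd δ i) ≠ 0 := by
    intro c
    obtain ⟨⟨b, j⟩, rfl⟩ := finProdFinEquiv.surjective c
    obtain ⟨i, hi⟩ := Function.ne_iff.mp (hS.1 j)
    exact ⟨i, by rw [hTl]; exact hi⟩
  have hne : ∀ s, T s ≠ 0 := by
    rintro (c | P) h
    · obtain ⟨i, hi⟩ := hleft c
      exact hi (congrFun h _)
    · apply P.rep_nonzero
      ext i
      rw [← hTr' P i, h]; rfl
  have hex : ∀ v, v ≠ 0 → ∃ (a : Fˣ) (s : _), a • T s = v := by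
    intro v hv
    by_cases h : (fun i => v (Fin.castAdd δ i)) = 0
    · have hv' : (fun i => v (Fin.natAdd k i)) ≠ 0 := by
        intro h'
        apply hv
        ext p
        exact Fin.addCases (fun i => congrFun h i) (fun i => congrFun h' i) p
      obtain ⟨a, ha⟩ := Projectivization.exists_smul_eq_mk_rep F _ hv'
      refine ⟨a⁻¹, .inr (Projectivization.mk F _ hv'), ?_⟩
      rw [inv_smul_eq_iff]
      ext p
      refine Fin.addCases (fun i => ?_) (fun i => ?_) p
      · have := congrFun h i
        simp only [Pi.zero_apply] at this
        rw [hTr, Pi.smul_apply, this, smul_zero]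
      · rw [hTr', ← ha]; rfl
    · obtain ⟨a, j, haj⟩ := hS.exists_smul_col_eq h
      -- The top of `v` fixes the column `j` and the scalar `a`; the block is then the one whose
      -- `x_b` is `a⁻¹` times the bottom of `v`.
      refine ⟨a, .inl (finProdFinEquiv (x.symm (a⁻¹ • fun i => v (Fin.natAdd k i)), j)), ?_⟩
      ext p
      refine Fin.addCases (fun i => ?_) (fun i => ?_) p
      · rw [Pi.smul_apply, hTl]
        exact congrFun haj i
      · rw [Pi.smul_apply, hTl', Equiv.apply_symm_apply, Pi.smul_apply, smul_inv_smul]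
  have huniq : ∀ s t (a : Fˣ), a • T s = T t → s = t := by
    rintro (c | P) (c' | P') a h
    · obtain ⟨⟨b, j⟩, rfl⟩ := finProdFinEquiv.surjective c
      obtain ⟨⟨b', j'⟩, rfl⟩ := finProdFinEquiv.surjective c'
      have h1 : a • S.col j = (1 : Fˣ) • S.col j' := by
        ext i
        have := congrFun h (Fin.castAdd δ i)
        rw [Pi.smul_apply, hTl, hTl] at this
        rw [one_smul]
        exact this
      obtain ⟨rfl, rfl⟩ := hS.eq_of_smul_col_eq h1
      have h2 : x b = x b' := by
        ext i
        have := congrFun h (Fin.natAdd k i)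
        rwa [Pi.smul_apply, hTl', hTl', one_smul] at this
      rw [x.injective h2]
    · obtain ⟨i, hi⟩ := hleft c
      have := congrFun h (Fin.castAdd δ i)
      rw [hTr, Pi.smul_apply, smul_eq_zero_iff_eq] at this
      exact absurd this hi
    · obtain ⟨i, hi⟩ := hleft c'
      have := congrFun h (Fin.castAdd δ i)
      rw [Pi.smul_apply, hTr, smul_zero] at this
      exact absurd this.symm hi
    · congr 1
      rw [← P.mk_rep, ← P'.mk_rep, Projectivization.mk_eq_mk_iff]
      refine ⟨a⁻¹, ?_⟩
      rw [inv_smul_eq_iff]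
      ext i
      have := congrFun h (Fin.natAdd k i)
      rw [Pi.smul_apply, hTr', hTr'] at this
      exact this.symm
  let e := Fintype.equivFin (Fin (L * N) ⊕ Projectivization F (Fin δ → F))
  refine ⟨_, Matrix.of fun p j => T (e.symm j) p, ⟨fun j => hne _, fun v hv => ?_⟩, ?_⟩
  · obtain ⟨a, s, hs⟩ := hex v hv
    refine ⟨e s, ?_, fun j hj => ?_⟩
    · refine Submodule.span_singleton_eq_span_singleton.mpr ⟨a, ?_⟩
      rw [← hs]
      ext p
      simp [Matrix.col_apply]
    · obtain ⟨b, hb⟩ := Submodule.span_singleton_eq_span_singleton.mp hj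
      rw [← e.symm_apply_eq]
      refine huniq _ _ (a⁻¹ * b) ?_
      rw [mul_smul, inv_smul_eq_iff, hs]
      exact hb
  · let f : Fin (L * N) → {j // ∃ i : Fin k, (Matrix.of fun p j => T (e.symm j) p)
        (Fin.castAdd δ i) j ≠ 0} :=
      fun c => ⟨e (.inl c), by simpa using hleft c⟩
    have hf : Function.Bijective f := by
      constructor
      · intro c c' h
        exact Sum.inl_injective (e.injective (congrArg Subtype.val h))
      · rintro ⟨j, hj⟩
        obtain ⟨s, rfl⟩ := e.surjective j
        obtain ⟨i, hi⟩ := hj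
        rw [Matrix.of_apply, Equiv.symm_apply_apply] at hi
        rcases s with c | P
        · exact ⟨c, rfl⟩
        · exact absurd (hTr P i) hi
    refine ⟨Equiv.ofBijective f hf, fun p c => ?_⟩
    change macDonaldBlocks S x p c = T (e.symm (e (.inl c))) p
    rw [e.symm_apply_apply]
    rfl

end MacDonald

/-! ### Indexing the rows of the stacked matrix -/

section StackIndex

variable {k δ : ℕ}

theorem mul_ceilDiv_lt (hk : 0 < k) : k * (δ ⌈/⌉ k) < k + δ := by
  rw [Nat.ceilDiv_eq_add_pred_div]
  have := Nat.mul_div_le (δ + k - 1) k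
  omega

theorem le_mul_ceilDiv (hk : 0 < k) : δ ≤ k * (δ ⌈/⌉ k) := by
  rw [Nat.ceilDiv_eq_add_pred_div]
  have := Nat.lt_mul_div_succ (δ + k - 1) hk
  rw [mul_add] at this
  omega

/-- The pair `(i, r)` such that row number `p` of the stacked matrix is row `r` of `G_i`. -/
def stackIndex (hk : 0 < k) (σ : Fin (k + δ - k * (δ ⌈/⌉ k)) ↪o Fin k) (p : Fin (k + δ)) :
    ℕ × Fin k :=
  if h : (p : ℕ) < k * (δ ⌈/⌉ k) then (p / k, ⟨p % k, Nat.mod_lt _ hk⟩)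
  else (δ ⌈/⌉ k, σ ⟨p - k * (δ ⌈/⌉ k), by have := p.isLt; omega⟩)

open Classical in
/-- The degree of row `r` of `G(z)`. -/
noncomputable def stackDegree (σ : Fin (k + δ - k * (δ ⌈/⌉ k)) ↪o Fin k) (r : Fin k) : ℕ :=
  if r ∈ Set.range σ then δ ⌈/⌉ k else δ ⌈/⌉ k - 1

variable (hk : 0 < k) (σ : Fin (k + δ - k * (δ ⌈/⌉ k)) ↪o Fin k)

theorem stackedCoeffs_apply {F : Type*} [Field F] {n : ℕ} (G : Matrix (Fin k) (Fin n) F[X])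
    (p : Fin (k + δ)) (c : Fin n) :
    stackedCoeffs σ G p c =
      (G (stackIndex hk σ p).2 c).coeff (stackIndex hk σ p).1 := by
  unfold stackedCoeffs stackIndex
  split_ifs <;> rfl

theorem stackIndex_injective : Function.Injective (stackIndex hk σ) := by
  intro p p' h
  have hlt : ∀ {a : ℕ}, a < k * (δ ⌈/⌉ k) → a / k < δ ⌈/⌉ k := fun h => Nat.div_lt_of_lt_mul h
  unfold stackIndex at h
  ext
  split_ifs at h with h1 h2 h2
  · simp only [Prod.mk.injEq, Fin.mk.injEq] at h
    rw [← Nat.div_add_mod (p : ℕ) k, ← Nat.div_add_mod (p' : ℕ) k, h.1, h.2]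
  · exact absurd (congrArg Prod.fst h) (hlt h1).ne
  · exact absurd (congrArg Prod.fst h) (hlt h2).ne'
  · have := congrArg Fin.val (σ.injective (congrArg Prod.snd h))
    simp only at this
    omega

/-- When `k` divides `δ`, all `k` rows of `G_μ` are chosen, so no row has degree `μ - 1`. -/
theorem surjective_of_mul_ceilDiv_eq (h : k * (δ ⌈/⌉ k) = δ) : Function.Surjective σ := by
  have hcard : k + δ - k * (δ ⌈/⌉ k) = k := by omega
  exact ((Fintype.bijective_iff_injective_and_card σ).mpr
    ⟨σ.injective, by simp [hcard]⟩).surjective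

theorem exists_stackIndex_eq_iff (i : ℕ) (r : Fin k) :
    (∃ p, stackIndex hk σ p = (i, r)) ↔ i ≤ stackDegree σ r := by
  have hδ := mul_ceilDiv_lt (δ := δ) hk
  constructor
  · rintro ⟨p, hp⟩
    unfold stackIndex at hp
    unfold stackDegree
    split_ifs at hp with h
    · have h1 : (p : ℕ) / k < δ ⌈/⌉ k := Nat.div_lt_of_lt_mul h
      have h2 : (p : ℕ) / k = i := congrArg Prod.fst hp
      split_ifs <;> omega
    · have h1 : δ ⌈/⌉ k = i := congrArg Prod.fst hp
      rw [if_pos ⟨_, congrArg Prod.snd hp⟩, h1]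
  · intro hi
    by_cases hlt : i < δ ⌈/⌉ k
    · have h1 : r + k * i < k * (δ ⌈/⌉ k) := by
        calc r + k * i < k * (i + 1) := by rw [mul_add, mul_one]; have := r.isLt; omega
          _ ≤ _ := Nat.mul_le_mul_left k hlt
      refine ⟨⟨r + k * i, h1.trans hδ⟩, ?_⟩
      unfold stackIndex
      rw [dif_pos h1]
      refine Prod.ext ?_ (Fin.ext ?_)
      · simp [Nat.add_mul_div_left _ _ hk, Nat.div_eq_of_lt r.isLt]
      · simp [Nat.mod_eq_of_lt r.isLt]
    · have hr : r ∈ Set.range σ ∧ i = δ ⌈/⌉ k := by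
        unfold stackDegree at hi
        split_ifs at hi with h
        · exact ⟨h, by omega⟩
        · have h0 : δ ⌈/⌉ k = 0 := by omega
          refine absurd (surjective_of_mul_ceilDiv_eq σ ?_ r) h
          have := le_mul_ceilDiv (δ := δ) hk
          rw [h0] at this ⊢
          omega
      obtain ⟨⟨s, rfl⟩, rfl⟩ := hr
      refine ⟨⟨k * (δ ⌈/⌉ k) + s, by have := s.isLt; omega⟩, ?_⟩
      unfold stackIndex
      rw [dif_neg (by simp)]
      refine Prod.ext rfl ?_
      simp

theorem stackIndex_fst_eq_zero_iff (p : Fin (k + δ)) :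
    (stackIndex hk σ p).1 = 0 ↔ (p : ℕ) < k := by
  have hδ := le_mul_ceilDiv (δ := δ) hk
  have hp := p.isLt
  unfold stackIndex
  split_ifs with h
  · rw [Nat.div_eq_zero_iff]
    omega
  · rcases Nat.eq_zero_or_pos (δ ⌈/⌉ k) with h0 | h0
    · rw [h0, mul_zero] at hδ
      simp only [h0, true_iff]
      omega
    · have := Nat.mul_le_mul_left k h0
      simp only [h0.ne', false_iff]
      omega

theorem div_le_stackDegree (r : Fin k) : δ / k ≤ stackDegree σ r := by
  have hk : 0 < k := r.pos
  have hle : δ / k ≤ δ ⌈/⌉ k := by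
    refine Nat.div_le_of_le_mul ?_
    exact le_mul_ceilDiv hk
  unfold stackDegree
  split_ifs with h
  · exact hle
  · rcases hle.lt_or_eq with hlt | heq
    · omega
    · refine absurd (surjective_of_mul_ceilDiv_eq σ ?_ r) h
      refine le_antisymm ?_ (le_mul_ceilDiv hk)
      rw [← heq]
      exact Nat.mul_div_le δ k

include hk in
-- Row `r` of `G` supplies `stackDegree σ r + 1` of the `k + δ` stacked rows.
theorem sum_stackDegree : ∑ r, stackDegree σ r = δ := by
  have h := Finset.card_eq_sum_card_fiberwise (s := (Finset.univ : Finset (Fin (k + δ))))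
    (t := (Finset.univ : Finset (Fin k))) (f := fun p => (stackIndex hk σ p).2)
    (fun _ _ => Finset.mem_coe.mpr (Finset.mem_univ _))
  have hr : ∀ r, (Finset.univ.filter fun p => (stackIndex hk σ p).2 = r).card =
      stackDegree σ r + 1 := by
    intro r
    rw [← Finset.card_range (stackDegree σ r + 1)]
    refine Finset.card_bij (fun p _ => (stackIndex hk σ p).1) ?_ ?_ ?_
    · intro p hp
      have hp := (Finset.mem_filter.mp hp).2
      have := (exists_stackIndex_eq_iff hk σ (stackIndex hk σ p).1 r).mp ⟨p, Prod.ext rfl hp⟩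
      exact Finset.mem_range.mpr (by omega)
    · intro p hp p' hp' h
      exact stackIndex_injective hk σ (Prod.ext h
        ((Finset.mem_filter.mp hp).2.trans (Finset.mem_filter.mp hp').2.symm))
    · intro i hi
      obtain ⟨p, hp⟩ := (exists_stackIndex_eq_iff hk σ i r).mpr
        (Nat.lt_succ_iff.mp (Finset.mem_range.mp hi))
      exact ⟨p, by simp [hp], by simp [hp]⟩
  simp only [hr, Finset.card_univ, Fintype.card_fin, Finset.sum_add_distrib, Finset.sum_const,
    smul_eq_mul, mul_one] at h
  omega

end StackIndex

/-! ### Recovering `G` from the stacked matrix: degrees and right inverse -/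

section Stacked

variable {F : Type*} [Field F] {k δ n : ℕ} (hk : 0 < k)
  {σ : Fin (k + δ - k * (δ ⌈/⌉ k)) ↪o Fin k} {G : Matrix (Fin k) (Fin n) F[X]}

theorem coeff_eq_zero_of_stackDegree_lt (hdeg : ∀ i, δ ⌈/⌉ k < i → coeffMatrix G i = 0)
    (hzero : ∀ r, r ∉ Set.range σ → (coeffMatrix G (δ ⌈/⌉ k)).row r = 0) {r : Fin k} {i : ℕ}
    (hi : stackDegree σ r < i) (c : Fin n) : (G r c).coeff i = 0 := by
  by_cases h : δ ⌈/⌉ k < i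
  · exact congrFun (congrFun (hdeg i h) r) c
  · unfold stackDegree at hi
    split_ifs at hi with hr
    · omega
    · have hi' : i = δ ⌈/⌉ k := by omega
      subst hi'
      exact congrFun (hzero r hr) c

variable (hG : ∀ r i, stackDegree σ r < i → ∀ c, (G r c).coeff i = 0)

include hG

theorem apply_eq_sum_stackedCoeffs (r : Fin k) (c : Fin n) :
    G r c = ∑ p, if (stackIndex hk σ p).2 = r then
      C (stackedCoeffs σ G p c) * X ^ (stackIndex hk σ p).1 else 0 := by
  ext i
  rw [finsetSum_coeff]
  by_cases hi : i ≤ stackDegree σ r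
  · obtain ⟨p, hp⟩ := (exists_stackIndex_eq_iff hk σ i r).mpr hi
    rw [Finset.sum_eq_single p]
    · rw [stackedCoeffs_apply hk]
      simp [hp]
    · intro p' _ hp'
      split_ifs with h
      · rw [coeff_C_mul_X_pow, if_neg]
        rintro rfl
        exact hp' (stackIndex_injective hk σ (by rw [hp, ← h]))
      · exact coeff_zero _
    · simp
  · rw [hG r i (by omega), Finset.sum_eq_zero]
    intro p _
    split_ifs with h
    · rw [coeff_C_mul_X_pow, if_neg]
      rintro rfl
      exact hi ((exists_stackIndex_eq_iff hk σ _ _).mp ⟨p, Prod.ext rfl h⟩)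
    · exact coeff_zero _

theorem vecMul_eq_sum_stackedCoeffs (u : Fin k → F[X]) (c : Fin n) :
    Matrix.vecMul u G c = ∑ p, u (stackIndex hk σ p).2 *
      (C (stackedCoeffs σ G p c) * X ^ (stackIndex hk σ p).1) := by
  simp only [Matrix.vecMul, dotProduct]
  rw [Finset.sum_congr rfl fun r _ => by rw [apply_eq_sum_stackedCoeffs hk hG r c]]
  simp only [Finset.mul_sum]
  rw [Finset.sum_comm]
  simp

/-- The coefficient vectors of the codewords lie in the row space of the stacked matrix. -/
theorem coeffVec_vecMul_eq_vecMul_stackedCoeffs (u : Fin k → F[X]) (t : ℕ) :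
    coeffVec (Matrix.vecMul u G) t = Matrix.vecMul (fun p => if (stackIndex hk σ p).1 ≤ t then
      (u (stackIndex hk σ p).2).coeff (t - (stackIndex hk σ p).1) else 0) (stackedCoeffs σ G) := by
  ext c
  rw [coeffVec, vecMul_eq_sum_stackedCoeffs hk hG, finsetSum_coeff]
  refine Finset.sum_congr rfl fun p _ => ?_
  rw [← mul_assoc, coeff_mul_X_pow']
  split_ifs with h
  · rw [coeff_mul_C]
    simp only [if_pos h]
  · simp only [if_neg h, zero_mul]

omit hG

variable (hM : LinearIndependent F (stackedCoeffs σ G).row)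

include hk hM

/-- One coefficient from each row of `G` selects distinct stacked rows. `e = 0` serves
delay-freeness, `e = stackDegree σ` serves row-reducedness. -/
theorem linearIndependent_coeff_of_le_stackDegree {e : Fin k → ℕ}
    (he : ∀ r, e r ≤ stackDegree σ r) :
    LinearIndependent F (Matrix.of fun r c => (G r c).coeff (e r)).row := by
  choose p hp using fun r => (exists_stackIndex_eq_iff hk σ (e r) r).mpr (he r)
  have hpinj : Function.Injective p := fun r s h => by
    have := hp r
    rw [h, hp s] at this
    exact (congrArg Prod.snd this).symm
  have heq : (Matrix.of fun r c => (G r c).coeff (e r)).row = (stackedCoeffs σ G).row ∘ p := by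
    ext r c
    simp only [Matrix.row_apply, Function.comp_apply, Matrix.of_apply]
    rw [stackedCoeffs_apply hk, hp]
  rw [heq]
  exact hM.comp p hpinj

theorem linearIndependent_coeffMatrix_zero : LinearIndependent F (coeffMatrix G 0).row :=
  linearIndependent_coeff_of_le_stackDegree hk hM (e := 0) fun _ => Nat.zero_le _

include hG

theorem internalDegree_eq_and_externalDegree_eq :
    internalDegree G = δ ∧ externalDegree G = δ := by
  have hdeg : ∀ r c, (G r c).natDegree ≤ stackDegree σ r := fun r c =>
    natDegree_le_iff_coeff_eq_zero.mpr fun i hi => hG r i hi c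
  have h1 : externalDegree G ≤ δ := by
    rw [← sum_stackDegree hk σ]
    exact Finset.sum_le_sum fun r _ => Finset.sup_le fun c _ => hdeg r c
  have h2 : internalDegree G ≤ externalDegree G :=
    Finset.sup_le fun f _ => natDegree_det_le_of_forall_le _ _ fun r j =>
      Finset.le_sup (f := fun c => (G r c).natDegree) (Finset.mem_univ (f j))
  have h3 : δ ≤ internalDegree G := by
    obtain ⟨f, hf⟩ := exists_orderEmbedding_det_submatrix_ne_zero _
      (linearIndependent_coeff_of_le_stackDegree hk hM (e := stackDegree σ) fun _ => le_rfl)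
    refine le_trans ?_ (Finset.le_sup (f := fun f : Fin k ↪o Fin n =>
      (G.submatrix id f).det.natDegree) (Finset.mem_univ f))
    refine le_natDegree_of_ne_zero ?_
    have := coeff_det_of_forall_natDegree_le (G.submatrix id f) (stackDegree σ)
      fun i j => hdeg i (f j)
    rw [sum_stackDegree hk σ] at this
    rw [this]
    exact hf
  omega

/-- The stacked matrix is onto, so some constant vector `w_r` is sent to the unit vector at stacked
row `(0, r)`. All higher coefficients of `G w_r` vanish, and the `w_r` are the columns of `P`. -/
theorem exists_mul_eq_one : ∃ P : Matrix (Fin n) (Fin k) F[X], G * P = 1 := by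
  classical
  have hsurj : Function.Surjective (stackedCoeffs σ G).mulVec := by
    have hrank : Module.finrank F (LinearMap.range (stackedCoeffs σ G).mulVecLin) = k + δ := by
      have := hM.rank_matrix
      rwa [Fintype.card_fin] at this
    have : LinearMap.range (stackedCoeffs σ G).mulVecLin = ⊤ :=
      Submodule.eq_top_of_finrank_eq (by simpa using hrank)
    exact LinearMap.range_eq_top.mp this
  choose p hp using fun r => (exists_stackIndex_eq_iff hk σ 0 r).mpr (Nat.zero_le _)
  choose w hw using fun r => hsurj (Pi.single (p r) 1)
  refine ⟨Matrix.of fun c r => C (w r c), ?_⟩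
  ext1 r r'
  have hw' : ∀ s, ∑ c, stackedCoeffs σ G s c * w r' c = Pi.single (M := fun _ => F) (p r') 1 s :=
    fun s => congrFun (hw r') s
  rw [Matrix.mul_apply]
  have : ∀ s : Fin (k + δ), ∑ c, (if (stackIndex hk σ s).2 = r then
      C (stackedCoeffs σ G s c) * X ^ (stackIndex hk σ s).1 else 0) * C (w r' c) =
      if s = p r' then (if r' = r then 1 else 0) else 0 := by
    intro s
    by_cases hs : s = p r'
    · subst hs
      have h1 := hw' (p r')
      rw [Pi.single_eq_same] at h1
      simp only [hp, if_true, pow_zero, mul_one]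
      split_ifs
      · simp only [← C_mul, ← map_sum, h1, C_1]
      · simp
    · have h1 := hw' s
      rw [Pi.single_eq_of_ne hs] at h1
      rw [if_neg hs]
      split_ifs
      · simp only [mul_right_comm _ (X ^ _), ← C_mul, ← Finset.sum_mul, ← map_sum, h1, C_0,
          zero_mul]
      · simp
  rw [Finset.sum_congr rfl fun c _ => by rw [apply_eq_sum_stackedCoeffs hk hG r c]]
  simp only [Matrix.of_apply, Finset.sum_mul]
  rw [Finset.sum_comm, Finset.sum_congr rfl fun s _ => this s]
  simp [Matrix.one_apply, eq_comm]

end Stacked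

/-! ### Exact weights of the coefficient vectors -/

section Construction

variable {F : Type*} [Field F] [Fintype F] [DecidableEq F] {k δ L N : ℕ} (hk : 0 < k)
  {S : Matrix (Fin k) (Fin N) F} (hS : IsSimplexMatrix S) (x : Fin L ≃ (Fin δ → F))
  {σ : Fin (k + δ - k * (δ ⌈/⌉ k)) ↪o Fin k} {G : Matrix (Fin k) (Fin (L * N)) F[X]}
  (hG : ∀ r i, stackDegree σ r < i → ∀ c, (G r c).coeff i = 0)
  (hstack : stackedCoeffs σ G = macDonaldBlocks S x)

include hk hS hG hstack

theorem hammingNorm_coeffVec_zero_of_stackedCoeffs_eq {v : Fin (L * N) → F[X]}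
    (hv : v ∈ codeOf G) (hv0 : coeffVec v 0 ≠ 0) :
    hammingNorm (coeffVec v 0) = Fintype.card F ^ (δ + k - 1) := by
  obtain ⟨u, rfl⟩ := mem_codeOf_iff.mp hv
  rw [coeffVec_vecMul_eq_vecMul_stackedCoeffs hk hG, hstack] at hv0 ⊢
  refine hammingNorm_vecMul_macDonaldBlocks_of_natAdd_eq_zero hk hS x (fun i => if_neg ?_) ?_
  · rw [Nat.le_zero, stackIndex_fst_eq_zero_iff hk σ]
    simp
  · rintro h
    rw [h, Matrix.zero_vecMul] at hv0
    exact hv0 rfl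

theorem hammingNorm_coeffVec_of_stackedCoeffs_eq {v : Fin (L * N) → F[X]}
    (hv : v ∈ codeOf G) (hv0 : coeffVec v 0 ≠ 0) {t : ℕ} (ht0 : 0 < t) (ht : t ≤ δ / k) :
    hammingNorm (coeffVec v t) = Fintype.card F ^ (δ + k - 1) - Fintype.card F ^ (δ - 1) := by
  obtain ⟨u, rfl⟩ := mem_codeOf_iff.mp hv
  rw [coeffVec_vecMul_zero] at hv0
  have hu : (fun r => (u r).coeff 0) ≠ 0 := by
    intro h
    rw [h, Matrix.zero_vecMul] at hv0
    exact hv0 rfl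
  obtain ⟨r, hr⟩ := Function.ne_iff.mp hu
  rw [coeffVec_vecMul_eq_vecMul_stackedCoeffs hk hG, hstack]
  refine hammingNorm_vecMul_macDonaldBlocks_of_natAdd_ne_zero hS x ?_
  -- The stacked row `(t, r)` exists since `t ≤ ⌊δ/k⌋`, and it carries the nonzero scalar `u_{r,0}`;
  -- as `t > 0`, it lies below the first `k` rows.
  obtain ⟨p, hp⟩ := (exists_stackIndex_eq_iff hk σ t r).mpr (ht.trans (div_le_stackDegree σ r))
  have hpk : ¬ (p : ℕ) < k := by
    rw [← stackIndex_fst_eq_zero_iff hk σ, hp]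
    exact ht0.ne'
  refine ⟨⟨p - k, by have := p.isLt; omega⟩, ?_⟩
  have hpp : Fin.natAdd k ⟨p - k, by have := p.isLt; omega⟩ = p := by
    ext
    simp only [Fin.natAdd_mk]
    omega
  rw [hpp, hp, if_pos le_rfl, Nat.sub_self]
  exact hr

theorem truncWeight_of_stackedCoeffs_eq {v : Fin (L * N) → F[X]}
    (hv : v ∈ codeOf G) (hv0 : coeffVec v 0 ≠ 0) {j : ℕ} (hj : j ≤ δ / k) :
    truncWeight j v = Fintype.card F ^ (δ + k - 1) +
      j * (Fintype.card F ^ (δ + k - 1) - Fintype.card F ^ (δ - 1)) := by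
  induction j with
  | zero =>
    rw [truncWeight_zero, hammingNorm_coeffVec_zero_of_stackedCoeffs_eq hk hS x hG hstack hv hv0]
    simp
  | succ j ih =>
    rw [truncWeight_succ, ih (by omega), add_mul, one_mul, add_assoc,
      hammingNorm_coeffVec_of_stackedCoeffs_eq hk hS x hG hstack hv hv0 (Nat.succ_pos j) hj]

end Construction

end ConvolutionalCode

theorem mainTheorem1 {F : Type*} [Field F] [Fintype F] [DecidableEq F]
    (q k δ : ℕ) (hq : Fintype.card F = q) (hk : 0 < k)
    (S : Matrix (Fin k) (Fin ((q ^ k - 1) / (q - 1))) F) (hS : IsSimplexMatrix S)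
    (x : Fin (q ^ δ) ≃ (Fin δ → F))
    (G : Matrix (Fin k) (Fin (q ^ δ * ((q ^ k - 1) / (q - 1)))) F[X])
    (σ : Fin (k + δ - k * (δ ⌈/⌉ k)) ↪o Fin k)
    (hdeg : ∀ i, δ ⌈/⌉ k < i → coeffMatrix G i = 0)
    (hzero : ∀ r, r ∉ Set.range σ → (coeffMatrix G (δ ⌈/⌉ k)).row r = 0)
    (hstack : stackedCoeffs σ G = macDonaldBlocks S x) :
    IsMacDonaldMatrix (macDonaldBlocks S x) ∧
    IsMinimalGeneratorMatrix G (codeOf G) ∧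
    IsConvCode (codeOf G) k δ ∧
    IsNonCatastrophic (codeOf G) k ∧
    HasOptimalColumnDistances (codeOf G) k δ ∧
    (∀ j ≤ δ / k, columnDistance (codeOf G) j =
      q ^ (δ + k - 1) + j * (q ^ (δ + k - 1) - q ^ (δ - 1))) ∧
    (∀ j ≥ δ / k, columnDistance (codeOf G) j =
      q ^ (δ + k - 1) + (δ / k) * (q ^ (δ + k - 1) - q ^ (δ - 1))) ∧
    freeDistance (codeOf G) =
      q ^ (δ + k - 1) + (δ / k) * (q ^ (δ + k - 1) - q ^ (δ - 1)) := by
  subst hq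
  have hG : ∀ r i, stackDegree σ r < i → ∀ c, (G r c).coeff i = 0 :=
    fun r i hi c => coeff_eq_zero_of_stackDegree_lt hdeg hzero hi c
  have hM : LinearIndependent F (stackedCoeffs σ G).row :=
    hstack ▸ linearIndependent_row_macDonaldBlocks hk hS x
  obtain ⟨P, hP⟩ := exists_mul_eq_one hk hG hM
  have hli := linearIndependent_row_of_mul_eq_one hP
  have hG0 := linearIndependent_coeffMatrix_zero hk hM
  obtain ⟨hint, hext⟩ := internalDegree_eq_and_externalDegree_eq hk hG hM
  have hmin : IsMinimalGeneratorMatrix G (codeOf G) := ⟨⟨hli, rfl⟩, hint.trans hext.symm⟩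
  have hconv : IsConvCode (codeOf G) k δ :=
    ⟨by rw [codeOf, finrank_span_eq_card hli, Fintype.card_fin], G, hmin, hext⟩
  have hdf : IsDelayFree (codeOf G) k := ⟨G, ⟨hli, rfl⟩, hG0⟩
  have htw : ∀ v ∈ codeOf G, coeffVec v 0 ≠ 0 → ∀ j ≤ δ / k, _ := fun v hv hv0 j hj =>
    truncWeight_of_stackedCoeffs_eq hk hS x hG hstack hv hv0 hj
  -- This single codeword, zero after time `⌊δ/k⌋`, attains every column distance and the free
  -- distance.
  obtain ⟨v, hv, hv0, hvm⟩ := exists_mem_coeffVec_zero_ne_zero_of_rowDegree_le hk hconv hdf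
  have hcol : ∀ j, columnDistance (codeOf G) j = Fintype.card F ^ (δ + k - 1) +
      min j (δ / k) * (Fintype.card F ^ (δ + k - 1) - Fintype.card F ^ (δ - 1)) := by
    intro j
    refine columnDistance_eq (fun w hw hw0 => ?_) ⟨v, hv, hv0, ?_⟩
    · rw [← htw w hw hw0 _ (min_le_right j _)]
      exact truncWeight_mono w (min_le_left _ _)
    · rw [← htw v hv hv0 _ (min_le_right j _)]
      rcases le_total j (δ / k) with h | h
      · rw [min_eq_left h]
      · rw [min_eq_right h, truncWeight_eq_of_coeffVec_eq_zero h hvm]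
  have hn : Fintype.card F ^ δ * ((Fintype.card F ^ k - 1) / (Fintype.card F - 1)) *
      (Fintype.card F - 1) = Fintype.card F ^ δ * (Fintype.card F ^ k - 1) := by
    rw [mul_assoc, mul_comm (_ / _), hS.card_sub_one_mul]
  refine ⟨isMacDonaldMatrix_macDonaldBlocks hS x, hmin, hconv, isNonCatastrophic_of_mul_eq_one hP,
    hasOptimalColumnDistances_of_columnDistance_eq hk hn hconv hdf hcol,
    fun j hj => ?_, fun j hj => ?_, ?_⟩
  · rw [hcol, min_eq_left hj]
  · rw [hcol, min_eq_right hj]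
  · exact freeDistance_eq hG0 (fun w hw hw0 => (htw w hw hw0 _ le_rfl).ge)
      ⟨v, hv, hv0, htw v hv hv0 _ le_rfl, hvm⟩
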